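/- Call a positive integer $t$ a powerful number if $t>1$ and $p^2\mid t$ for every prime divisor $p$ of $t$. Let $q$ be a positive integer and let $\ell$ be an odd prime power, that is, $\ell=k^s$ with $k$ an odd prime and $s\ge 1$ an integer. Then for every integer $n\ge\max\{q,\,11-q\}$, the product $$(1^\ell+q^\ell)(2^\ell+q^\ell)\cdots(n^\ell+q^\ell)$$ is not a powerful number. -/

import Mathlib

/-- A positive integer `t` is a powerful number if `t > 1` and `p ^ 2 ∣ t` for every prime
divisor `p` of `t`. -/
def IsPowerful (t : ℕ) : Prop :=
  1 < t ∧ ∀ p : ℕ, p.Prime → p ∣ t → p ^ 2 ∣ t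

open Finset ArithmeticFunction

/-! Put N = n + q ≥ 11. It suffices to find a prime p in (N/2, N] with p ≠ k and p ≢ 1 mod k. Then q
< p, and the factor with a = p - q is divisible by p. As ℓ = k^s is coprime to p - 1, the ℓ-th power
map is injective on units mod p, so p ∣ a^ℓ + q^ℓ forces p ∣ a + q; since 0 < a + q ≤ N < 2p, only a
= p - q occurs. Lifting the exponent gives that factor p-adic valuation v(p) + v(ℓ) = 1, so p
divides the product exactly once.

For N ≥ 10^8 the prime p exists because Chebyshev's method gives the primes in (N/2, N] logarithmic
weight at least 0.347 N, while those ≡ 1 mod k weigh less: at most about 0.255 N for k ≥ 5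
(`sum_prime_log_one_mod_le`, from the product of the numbers 2kj + 1), and, if k = 3 and no prime
there is ≡ 2 mod 3, at most about 0.291 N (`sum_prime_log_one_mod_three_le`, from the character mod
3). Smaller N are covered by a finite chain of prime pairs. -/

/-! ### Factorials via the von Mangoldt function, and Stirling bounds -/

/-- Summing `log (g j)` over `j`, expanded through the von Mangoldt function. -/
theorem sum_log_eq_sum_vonMangoldt_mul_card {ι : Type*} (J : Finset ι) (g : ι → ℕ) (N : ℕ)
    (hg : ∀ j ∈ J, 0 < g j ∧ g j ≤ N) :
    ∑ j ∈ J, Real.log (g j) =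
      ∑ d ∈ Ioc 0 N, vonMangoldt d * (#{j ∈ J | d ∣ g j} : ℝ) := by
  have h1 : ∀ j ∈ J, Real.log (g j) = ∑ d ∈ Ioc 0 N, if d ∣ g j then vonMangoldt d else 0 := by
    intro j hj
    rw [← vonMangoldt_sum, ← sum_filter]
    refine sum_congr ?_ fun _ _ ↦ rfl
    ext d
    simp only [Nat.mem_divisors, mem_filter, mem_Ioc]
    constructor
    · rintro ⟨hd, -⟩
      exact ⟨⟨Nat.pos_of_dvd_of_pos hd (hg j hj).1,
        (Nat.le_of_dvd (hg j hj).1 hd).trans (hg j hj).2⟩, hd⟩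
    · rintro ⟨-, hd⟩
      exact ⟨hd, (hg j hj).1.ne'⟩
  rw [sum_congr rfl h1, sum_comm]
  refine sum_congr rfl fun d _ ↦ ?_
  rw [← sum_filter, sum_const, nsmul_eq_mul, mul_comm]

theorem log_factorial_eq_sum_vonMangoldt (n : ℕ) :
    Real.log (n.factorial : ℝ) = ∑ d ∈ Ioc 0 n, vonMangoldt d * ((n / d : ℕ) : ℝ) := by
  have h : (n.factorial : ℝ) = ∏ j ∈ Ioc 0 n, (j : ℝ) := by
    rw [← prod_Ico_id_eq_factorial, ← Ico_add_one_add_one_eq_Ioc]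
    push_cast
    rfl
  rw [h, Real.log_prod (fun j hj ↦ by have := (mem_Ioc.1 hj).1; positivity),
    sum_log_eq_sum_vonMangoldt_mul_card (Ioc 0 n) (fun j ↦ j) n (fun j hj ↦ mem_Ioc.1 hj)]
  simp_rw [Nat.Ioc_filter_dvd_card_eq_div]

theorem log_factorial_div_eq_sum_vonMangoldt (n m : ℕ) :
    Real.log ((n / m).factorial : ℝ) =
      ∑ d ∈ Ioc 0 n, vonMangoldt d * ((n / d / m : ℕ) : ℝ) := by
  rw [log_factorial_eq_sum_vonMangoldt]
  have h : ∀ d, n / m / d = n / d / m := fun d ↦ by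
    rw [Nat.div_div_eq_div_mul, Nat.div_div_eq_div_mul, mul_comm]
  simp_rw [h]
  refine sum_subset (Ioc_subset_Ioc_right (Nat.div_le_self n m)) fun d hd hd' ↦ ?_
  rw [← h, Nat.div_eq_of_lt (by simp only [mem_Ioc] at hd hd'; omega)]
  simp

theorem mul_log_sub_self_le_log_factorial (n : ℕ) :
    n * Real.log n - n ≤ Real.log (n.factorial : ℝ) := by
  rcases n.eq_zero_or_pos with rfl | hn
  · simp
  have h := Real.pow_div_factorial_le_exp (x := (n : ℝ)) (by positivity) n
  have h2 := Real.log_le_log (by positivity) h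
  rw [Real.log_exp, Real.log_div (by positivity) (by positivity), Real.log_pow] at h2
  linarith

theorem log_factorial_le_mul_log_sub_self {n : ℕ} (hn : 1 ≤ n) :
    Real.log (n.factorial : ℝ) ≤ n * Real.log n - n + Real.log n + 1 := by
  induction n, hn using Nat.le_induction with
  | base => simp
  | succ n hn ih =>
    have hn' : (0 : ℝ) < n := by exact_mod_cast hn
    rw [Nat.factorial_succ, Nat.cast_mul, Real.log_mul (by positivity) (by positivity)]
    have h1 : 1 / ((n : ℝ) + 1) ≤ Real.log (n + 1) - Real.log n := by
      rw [← Real.log_div (by positivity) (by positivity)]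
      have := Real.one_sub_inv_le_log_of_pos (x := ((n : ℝ) + 1) / n) (by positivity)
      refine le_trans (le_of_eq ?_) this
      field_simp
      ring
    have h2 : 1 ≤ ((n : ℝ) + 1) * (Real.log (n + 1) - Real.log n) := by
      rw [div_le_iff₀' (by positivity)] at h1
      exact h1
    push_cast
    nlinarith

theorem mul_log_sub_self_mono {x y : ℝ} (hx : 1 ≤ x) (hxy : x ≤ y) :
    x * Real.log x - x ≤ y * Real.log y - y := by
  have hx0 : 0 < x := by linarith
  have hy0 : 0 < y := by linarith
  have h1 := Real.one_sub_inv_le_log_of_pos (x := y / x) (by positivity)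
  rw [Real.log_div hy0.ne' hx0.ne', inv_div] at h1
  have h2 : y - x ≤ y * (Real.log y - Real.log x) := by
    have := mul_le_mul_of_nonneg_left h1 hy0.le
    rwa [mul_sub, mul_one, mul_div_cancel₀ _ hy0.ne'] at this
  have h3 := Real.log_nonneg hx
  nlinarith [mul_nonneg (sub_nonneg.2 hxy) h3]

theorem abs_log_factorial_div_sub_le {n m : ℕ} (hm : 0 < m) (hmn : m ≤ n) :
    |Real.log ((n / m).factorial : ℝ) - ((n / m : ℝ) * Real.log (n / m) - n / m)| ≤
      Real.log n + 1 := by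
  have hm' : (1 : ℝ) ≤ m := by exact_mod_cast hm
  have hmn' : (m : ℝ) ≤ n := by exact_mod_cast hmn
  have hx : (1 : ℝ) ≤ n / m := by rw [le_div_iff₀ (by linarith)]; linarith
  have hq : 1 ≤ n / m := (Nat.one_le_div_iff hm).2 hmn
  have hq' : (1 : ℝ) ≤ (n / m : ℕ) := by exact_mod_cast hq
  have hle : ((n / m : ℕ) : ℝ) ≤ n / m := Nat.cast_div_le
  have hlt : (n / m : ℝ) ≤ (n / m : ℕ) + 1 := by
    rw [div_le_iff₀ (by linarith)]
    have := (Nat.lt_div_mul_add (a := n) hm).le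
    have h3 : (n : ℝ) ≤ (n / m : ℕ) * m + m := by exact_mod_cast this
    linarith
  have hqn : ((n / m : ℕ) : ℝ) ≤ n := by exact_mod_cast Nat.div_le_self n m
  have hlog : Real.log (n / m : ℕ) ≤ Real.log n := Real.log_le_log (by linarith) hqn
  have up := log_factorial_le_mul_log_sub_self hq
  have mono1 := mul_log_sub_self_mono hq' hle
  have low := mul_log_sub_self_le_log_factorial (n / m + 1)
  rw [Nat.factorial_succ, Nat.cast_mul, Real.log_mul (by positivity) (by positivity)] at low
  have mono2 := mul_log_sub_self_mono hx hlt
  push_cast at low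
  have hlog2 : Real.log (((n / m : ℕ) : ℝ) + 1) ≤ Real.log n + 1 := by
    have : Real.log (((n / m : ℕ) : ℝ) + 1) ≤ Real.log (2 * n) :=
      Real.log_le_log (by linarith) (by linarith)
    rw [Real.log_mul (by norm_num) (by linarith)] at this
    linarith [Real.log_two_lt_d9]
  rw [abs_le]
  constructor <;> linarith

/-! ### Chebyshev's bounds for ψ, and the weight of primes in (N/2, N] -/

/-- Chebyshev's combination of logarithms of factorials. -/
noncomputable def chebyshevCombination (n : ℕ) : ℝ :=
  Real.log (n.factorial : ℝ) - Real.log ((n / 2).factorial : ℝ) -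
    Real.log ((n / 3).factorial : ℝ) - Real.log ((n / 5).factorial : ℝ) +
    Real.log ((n / 30).factorial : ℝ)

/-- The coefficient of Λ(d) depends only on x = ⌊n/d⌋. Since 1 + 1/30 = 1/2 + 1/3 + 1/5 it is
periodic mod 30; it takes only the values 0 and 1, and is 1 for 1 ≤ x < 6. This sandwiches the
combination between ψ(n) - ψ(n/6) and ψ(n). -/
theorem chebyshevCombination_eq_sum (n : ℕ) :
    chebyshevCombination n = ∑ d ∈ Ioc 0 n, vonMangoldt d *
      (((n / d : ℕ) : ℝ) - (n / d / 2 : ℕ) - (n / d / 3 : ℕ) - (n / d / 5 : ℕ)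
        + (n / d / 30 : ℕ)) := by
  rw [chebyshevCombination, log_factorial_eq_sum_vonMangoldt]
  simp_rw [log_factorial_div_eq_sum_vonMangoldt, mul_add, mul_sub, sum_add_distrib,
    sum_sub_distrib]

theorem chebyshev_coefficient_le_one (x : ℕ) :
    (x : ℝ) - (x / 2 : ℕ) - (x / 3 : ℕ) - (x / 5 : ℕ) + (x / 30 : ℕ) ≤ 1 := by
  have : x + x / 30 ≤ 1 + x / 2 + x / 3 + x / 5 := by omega
  have : (x : ℝ) + (x / 30 : ℕ) ≤ 1 + (x / 2 : ℕ) + (x / 3 : ℕ) + (x / 5 : ℕ) := by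
    exact_mod_cast this
  linarith

theorem chebyshev_coefficient_nonneg (x : ℕ) :
    0 ≤ (x : ℝ) - (x / 2 : ℕ) - (x / 3 : ℕ) - (x / 5 : ℕ) + (x / 30 : ℕ) := by
  have : x / 2 + x / 3 + x / 5 ≤ x + x / 30 := by omega
  have : ((x / 2 : ℕ) : ℝ) + (x / 3 : ℕ) + (x / 5 : ℕ) ≤ x + (x / 30 : ℕ) := by
    exact_mod_cast this
  linarith

theorem chebyshev_coefficient_eq_one {x : ℕ} (h1 : 1 ≤ x) (h6 : x < 6) :
    (x : ℝ) - (x / 2 : ℕ) - (x / 3 : ℕ) - (x / 5 : ℕ) + (x / 30 : ℕ) = 1 := by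
  interval_cases x <;> norm_num

theorem psi_natCast (n : ℕ) : Chebyshev.psi n = ∑ d ∈ Ioc 0 n, vonMangoldt d := by
  rw [Chebyshev.psi, Nat.floor_natCast]

theorem theta_natCast (n : ℕ) : Chebyshev.theta n = ∑ p ∈ Ioc 0 n with p.Prime, Real.log p := by
  rw [Chebyshev.theta, Nat.floor_natCast]

theorem psi_sub_psi_eq_sum {m n : ℕ} (h : m ≤ n) :
    Chebyshev.psi n - Chebyshev.psi m = ∑ d ∈ Ioc m n, vonMangoldt d := by
  rw [psi_natCast, psi_natCast, ← sum_Ioc_consecutive _ (Nat.zero_le m) h]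
  ring

theorem chebyshevCombination_le_psi (n : ℕ) : chebyshevCombination n ≤ Chebyshev.psi n := by
  rw [chebyshevCombination_eq_sum, psi_natCast]
  exact sum_le_sum fun d _ ↦
    mul_le_of_le_one_right vonMangoldt_nonneg (chebyshev_coefficient_le_one _)

theorem psi_sub_psi_div_six_le (n : ℕ) :
    Chebyshev.psi n - Chebyshev.psi (n / 6 : ℕ) ≤ chebyshevCombination n := by
  rw [chebyshevCombination_eq_sum, psi_sub_psi_eq_sum (Nat.div_le_self n 6)]
  refine (sum_le_sum fun d hd ↦ ?_).trans
    (sum_le_sum_of_subset_of_nonneg (Ioc_subset_Ioc_left (Nat.zero_le (n / 6))) fun d _ _ ↦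
      mul_nonneg vonMangoldt_nonneg (chebyshev_coefficient_nonneg _))
  rw [mem_Ioc] at hd
  have hd0 : 0 < d := by omega
  rw [chebyshev_coefficient_eq_one ((Nat.one_le_div_iff hd0).2 hd.2)
    ((Nat.div_lt_iff_lt_mul hd0).2 (by omega)), mul_one]

/-- By Stirling the n log n and n terms cancel, leaving n (log 2 / 2 + log 3 / 3 + log 5 / 5 - log
30 / 30) ≈ 0.92129 n, with an error of at most log n + 1 from each of the five factorials. -/
theorem chebyshevCombination_bounds {n : ℕ} (hn : 30 ≤ n) :
    0.9212 * n - 5 * (Real.log n + 1) ≤ chebyshevCombination n ∧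
      chebyshevCombination n ≤ 0.9213 * n + 5 * (Real.log n + 1) := by
  have hn' : (30 : ℝ) ≤ n := by exact_mod_cast hn
  have h1 := abs_le.1 (abs_log_factorial_div_sub_le (n := n) (m := 1) (by norm_num) (by omega))
  have h2 := abs_le.1 (abs_log_factorial_div_sub_le (n := n) (m := 2) (by norm_num) (by omega))
  have h3 := abs_le.1 (abs_log_factorial_div_sub_le (n := n) (m := 3) (by norm_num) (by omega))
  have h5 := abs_le.1 (abs_log_factorial_div_sub_le (n := n) (m := 5) (by norm_num) (by omega))
  have h30 := abs_le.1 (abs_log_factorial_div_sub_le (n := n) (m := 30) (by norm_num) (by omega))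
  have l30 : Real.log 30 = Real.log 2 + Real.log 3 + Real.log 5 := by
    rw [← Real.log_mul (by norm_num) (by norm_num), ← Real.log_mul (by norm_num) (by norm_num)]
    norm_num
  have hd : ∀ m : ℝ, m ≠ 0 → Real.log (n / m) = Real.log n - Real.log m := fun m hm ↦
    Real.log_div (by linarith) hm
  push_cast at h1 h2 h3 h5 h30
  rw [hd _ (by norm_num)] at h1 h2 h3 h5 h30
  rw [l30] at h30
  rw [Real.log_one, Nat.div_one] at h1
  have key : (n : ℝ) * (0.9212 : ℝ) ≤ n * (Real.log 2 * (7 / 15) + Real.log 3 * (3 / 10) +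
      Real.log 5 * (1 / 6)) := by
    gcongr
    linarith [Real.log_two_gt_d9, Real.log_three_gt_d9, Real.log_five_gt_d9]
  have key' : n * (Real.log 2 * (7 / 15) + Real.log 3 * (3 / 10) +
      Real.log 5 * (1 / 6)) ≤ (n : ℝ) * (0.9213 : ℝ) := by
    gcongr
    linarith [Real.log_two_lt_d9, Real.log_three_lt_d9, Real.log_five_lt_d9]
  have e : ((n : ℝ) / 1 * (Real.log n - 0) - n / 1) -
      (n / 2 * (Real.log n - Real.log 2) - n / 2) - (n / 3 * (Real.log n - Real.log 3) - n / 3) -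
      (n / 5 * (Real.log n - Real.log 5) - n / 5) +
      (n / 30 * (Real.log n - (Real.log 2 + Real.log 3 + Real.log 5)) - n / 30) =
      n * (Real.log 2 * (7 / 15) + Real.log 3 * (3 / 10) + Real.log 5 * (1 / 6)) := by ring
  rw [chebyshevCombination]
  constructor <;> linarith

theorem psi_ge_mul {n : ℕ} (hn : 30 ≤ n) :
    0.9212 * n - 5 * (Real.log n + 1) ≤ Chebyshev.psi n :=
  (chebyshevCombination_bounds hn).1.trans (chebyshevCombination_le_psi n)

/-- Tangent line of log at 2^k; k is chosen near the size of x in each use. -/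
theorem log_le_div_add {x : ℝ} (hx : 0 < x) (k : ℕ) : Real.log x ≤ x / 2 ^ k - 1 + k * 0.6932 := by
  have h := Real.log_le_sub_one_of_pos (x := x / 2 ^ k) (by positivity)
  rw [Real.log_div (by positivity) (by positivity), Real.log_pow] at h
  have : (k : ℝ) * Real.log 2 ≤ k * 0.6932 := by
    gcongr
    linarith [Real.log_two_lt_d9]
  linarith

/-- Iterating ψ(n) - ψ(n/6) ≤ 0.9213 n + O(log n) gives slope (6/5) · 0.9213 < 1.13. The excess
absorbs the logarithms once n ≥ 2500, and 14000 covers the base range, where 5.4 · 2500 = 13500. -/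
theorem psi_le_mul_add (n : ℕ) : Chebyshev.psi n ≤ 1.13 * n + 14000 := by
  induction n using Nat.strong_induction_on with
  | _ n ih =>
    rcases lt_or_ge n 2500 with hn | hn
    · have h := Chebyshev.psi_le_const_mul_self (x := (n : ℝ)) (by positivity)
      have hn' : (n : ℝ) ≤ 2500 := by exact_mod_cast hn.le
      have h4 : Real.log 4 + 4 ≤ 5.4 := by
        rw [Real.log_four_eq]
        linarith [Real.log_two_lt_d9]
      have : (Real.log 4 + 4) * n ≤ 5.4 * 2500 := by gcongr
      have : (0 : ℝ) ≤ n := by positivity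
      linarith
    · have hn' : (2500 : ℝ) ≤ n := by exact_mod_cast hn
      have h1 := ih (n / 6) (by omega)
      have h2 := psi_sub_psi_div_six_le n
      have h3 := (chebyshevCombination_bounds (n := n) (by omega)).2
      have h4 : ((n / 6 : ℕ) : ℝ) ≤ n / 6 := Nat.cast_div_le
      have h5 := log_le_div_add (x := (n : ℝ)) (by linarith) 11
      norm_num at h5
      linarith

theorem two_mul_sqrt_mul_log_le {x : ℝ} (hx : 10 ^ 8 ≤ x) :
    2 * √x * Real.log x ≤ 0.008 * x := by
  have hx0 : 0 < x := by linarith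
  have hs : (10 : ℝ) ^ 4 ≤ √x := Real.le_sqrt_of_sq_le (by linarith)
  have hsq := Real.mul_self_sqrt hx0.le
  have h1 := log_le_div_add (x := √x) (by linarith) 10
  rw [Real.log_sqrt hx0.le] at h1
  norm_num at h1
  nlinarith

theorem log_le_mul {x : ℝ} (hx : 10 ^ 8 ≤ x) : Real.log x ≤ 0.0001 * x := by
  have h1 := log_le_div_add (x := x) (by linarith) 20
  norm_num at h1
  linarith

theorem psi_sub_psi_half_ge {n : ℕ} (hn : 10 ^ 8 ≤ n) :
    0.355 * n ≤ Chebyshev.psi n - Chebyshev.psi (n / 2 : ℕ) := by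
  have hn' : (10 : ℝ) ^ 8 ≤ n := by exact_mod_cast hn
  have h1 := psi_ge_mul (n := n) (by omega)
  have h2 := psi_le_mul_add (n / 2)
  have h3 : ((n / 2 : ℕ) : ℝ) ≤ n / 2 := Nat.cast_div_le
  have h4 := log_le_mul hn'
  linarith

theorem psi_sub_theta_le_mul {n : ℕ} (hn : 10 ^ 8 ≤ n) :
    Chebyshev.psi n - Chebyshev.theta n ≤ 0.008 * n := by
  have hn' : (10 : ℝ) ^ 8 ≤ n := by exact_mod_cast hn
  exact (Chebyshev.psi_sub_theta_le (by linarith)).trans (two_mul_sqrt_mul_log_le hn')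

theorem sum_prime_log_half_ge {n : ℕ} (hn : 10 ^ 8 ≤ n) :
    0.347 * n ≤ ∑ p ∈ Ioc (n / 2) n with p.Prime, Real.log p := by
  have h1 := psi_sub_psi_half_ge hn
  have h2 := psi_sub_theta_le_mul hn
  have h3 := Chebyshev.theta_le_psi (n / 2 : ℕ)
  have h4 : Chebyshev.theta n - Chebyshev.theta (n / 2 : ℕ) =
      ∑ p ∈ Ioc (n / 2) n with p.Prime, Real.log p := by
    rw [theta_natCast, theta_natCast, sum_filter, sum_filter, sum_filter,
      ← sum_Ioc_consecutive _ (Nat.zero_le (n / 2)) (Nat.div_le_self n 2)]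
    ring
  linarith

/-! ### Primes ≡ 1 mod k for k ≥ 5 -/

/-- Legendre's formula: the sum is the contribution of q to log t!, supported on powers of q and
bounded by a geometric series. -/
theorem sum_vonMangoldt_mul_div_of_dvd_le {q : ℕ} (hq : q.Prime) (t : ℕ) :
    ∑ d ∈ Ioc 0 t with q ∣ d, vonMangoldt d * ((t / d : ℕ) : ℝ) ≤
      Real.log q * ((t / (q - 1) : ℕ) : ℝ) := by
  have hsub : {x ∈ {d ∈ Ioc 0 t | q ∣ d} | vonMangoldt x * ((t / x : ℕ) : ℝ) ≠ 0} ⊆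
      (Ico 1 (t + 1)).image (q ^ ·) := by
    intro d hd
    simp only [mem_filter, mem_Ioc, ne_eq, mul_eq_zero, not_or] at hd
    obtain ⟨⟨⟨-, hdt⟩, hqd⟩, hΛ, -⟩ := hd
    obtain ⟨p, i, hp, hi, rfl⟩ := (isPrimePow_nat_iff d).1 (vonMangoldt_ne_zero_iff.1 hΛ)
    obtain rfl := (Nat.prime_dvd_prime_iff_eq hq hp).1 (hq.dvd_of_dvd_pow hqd)
    refine mem_image.2 ⟨i, mem_Ico.2 ⟨hi, ?_⟩, rfl⟩
    have := Nat.lt_pow_self hq.one_lt (n := i)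
    omega
  rw [← sum_filter_ne_zero]
  refine (sum_le_sum_of_subset_of_nonneg hsub fun d _ _ ↦
    mul_nonneg vonMangoldt_nonneg (Nat.cast_nonneg _)).trans ?_
  rw [sum_image fun i _ j _ h ↦ Nat.pow_right_injective hq.two_le h]
  have h : ∀ i ∈ Ico 1 (t + 1), vonMangoldt (q ^ i) * ((t / q ^ i : ℕ) : ℝ) =
      Real.log q * ((t / q ^ i : ℕ) : ℝ) := fun i hi ↦ by
    rw [vonMangoldt_apply_pow (by have := (mem_Ico.1 hi).1; omega), vonMangoldt_apply_prime hq]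
  rw [sum_congr rfl h, ← mul_sum, ← Nat.cast_sum]
  refine mul_le_mul_of_nonneg_left ?_ (Real.log_natCast_nonneg q)
  exact_mod_cast Nat.geom_sum_Ico_le hq.two_le t (t + 1)

theorem log_factorial_le_sum_coprime_add {k : ℕ} (hk : k.Prime) (t : ℕ) :
    Real.log (t.factorial : ℝ) ≤
      ∑ d ∈ Ioc 0 t with d.Coprime (2 * k), vonMangoldt d * ((t / d : ℕ) : ℝ) +
        (Real.log 2 * t + Real.log k * ((t / (k - 1) : ℕ) : ℝ)) := by
  have h2 := sum_vonMangoldt_mul_div_of_dvd_le Nat.prime_two t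
  have h3 := sum_vonMangoldt_mul_div_of_dvd_le hk t
  norm_num at h2
  rw [log_factorial_eq_sum_vonMangoldt, ← sum_filter_add_sum_filter_not _ (·.Coprime (2 * k))]
  gcongr
  refine le_trans ?_ (add_le_add h2 h3)
  simp_rw [sum_filter]
  rw [← sum_add_distrib]
  refine sum_le_sum fun d _ ↦ ?_
  have h0 : 0 ≤ vonMangoldt d * ((t / d : ℕ) : ℝ) :=
    mul_nonneg vonMangoldt_nonneg (Nat.cast_nonneg _)
  by_cases hc : d.Coprime (2 * k)
  · rw [if_neg (not_not.2 hc)]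
    split_ifs <;> linarith
  · rw [if_pos hc]
    rw [Nat.coprime_mul_iff_right, not_and_or] at hc
    rcases hc with hc | hc
    · rw [Nat.coprime_comm, Nat.Prime.coprime_iff_not_dvd Nat.prime_two, not_not] at hc
      rw [if_pos hc]
      split_ifs <;> linarith
    · rw [Nat.coprime_comm, Nat.Prime.coprime_iff_not_dvd hk, not_not] at hc
      rw [if_pos hc]
      split_ifs <;> linarith

/-- As M is invertible mod d, a whole residue class of j mod d satisfies the divisibility. -/
theorem div_le_card_dvd_mul_add_one {d M : ℕ} (hd : 0 < d) (hM : d.Coprime M) (a b : ℕ) :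
    (b - a) / d ≤ #{j ∈ Ioc a b | d ∣ M * j + 1} := by
  obtain ⟨v, hv⟩ : ∃ v, d ∣ M * v + 1 := by
    have hu : IsUnit (M : ZMod d) := (ZMod.isUnit_iff_coprime M d).2 hM.symm
    have : NeZero d := ⟨hd.ne'⟩
    obtain ⟨u, hu⟩ := hu
    refine ⟨(-(↑u⁻¹ : ZMod d)).val, ?_⟩
    rw [← ZMod.natCast_eq_zero_iff]
    push_cast
    rw [ZMod.natCast_zmod_val, ← hu]
    simp
  have hiff : ∀ j, j ≡ v [MOD d] → d ∣ M * j + 1 := fun j hj ↦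
    Nat.modEq_zero_iff_dvd.1
      (((hj.mul_left M).add_right 1).trans (Nat.modEq_zero_iff_dvd.2 hv))
  refine le_trans ?_ (card_le_card (monotone_filter_right (Ioc a b) fun j _ ↦ hiff j))
  rcases le_total b a with hab | hab
  · simp [Nat.sub_eq_zero_of_le hab]
  have hcard := Nat.Ioc_filter_modEq_card a b hd v
  have hd' : (0 : ℚ) < d := by exact_mod_cast hd
  have hle : (((b - a) / d : ℕ) : ℚ) ≤ (b - a) / d := by
    have : (((b - a) / d : ℕ) : ℚ) ≤ ((b - a : ℕ) : ℚ) / d := Nat.cast_div_le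
    rwa [Nat.cast_sub hab] at this
  have hfl : ⌊((a : ℚ) - v) / d⌋ + ((b - a) / d : ℕ) ≤ ⌊((b : ℚ) - v) / d⌋ := by
    rw [← Int.floor_add_natCast]
    refine Int.floor_le_floor ?_
    have : ((b : ℚ) - v) / d = (a - v) / d + (b - a) / d := by ring
    rw [this]
    gcongr
  have : (((b - a) / d : ℕ) : ℤ) ≤ (#{x ∈ Ioc a b | x ≡ v [MOD d]} : ℤ) := by
    rw [hcard]
    exact le_max_of_le_left (by linarith)
  exact_mod_cast this

/-- Both sums are parts of log ∏ (2kj + 1), over the j with N/2 < 2kj + 1 ≤ N. Every prime ≡ 1 mod k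
in (N/2, N] is one of these factors. Every d coprime to 2k divides at least ⌊t/d⌋ of the t factors,
so the product also carries nearly all of t!. -/
theorem sum_prime_log_add_sum_le {k N : ℕ} (hk : 5 ≤ k) (hodd : Odd k) (hN : 100 ≤ N) :
    ∑ p ∈ Ioc (N / 2) N with p.Prime ∧ p % k = 1, Real.log p +
      ∑ d ∈ Ioc 0 ((N - 1) / (2 * k) - (N - 2) / (2 * (2 * k))) with d.Coprime (2 * k),
        vonMangoldt d *
          ((((N - 1) / (2 * k) - (N - 2) / (2 * (2 * k))) / d : ℕ) : ℝ) ≤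
      ((N - 1) / (2 * k) - (N - 2) / (2 * (2 * k)) : ℕ) * Real.log N := by
  set b := (N - 1) / (2 * k) with hb
  set a := (N - 2) / (2 * (2 * k)) with ha
  have hbN : b * (2 * k) ≤ N - 1 := Nat.div_mul_le_self _ _
  have hb2 : b ≤ N / 2 := by
    have : b * 10 ≤ b * (2 * k) := by gcongr; omega
    omega
  have hg : ∀ j ∈ Ioc a b, 0 < 2 * k * j + 1 ∧ 2 * k * j + 1 ≤ N := fun j hj ↦ by
    refine ⟨by omega, ?_⟩
    have := Nat.mul_le_mul_right (2 * k) (mem_Ioc.1 hj).2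
    rw [mul_comm (2 * k) j]
    omega
  have hup : ∑ j ∈ Ioc a b, Real.log ((2 * k * j + 1 : ℕ) : ℝ) ≤ (b - a : ℕ) * Real.log N := by
    refine (sum_le_card_nsmul _ _ _ fun j hj ↦ Real.log_le_log ?_ ?_).trans_eq
      (by rw [Nat.card_Ioc, nsmul_eq_mul])
    · exact_mod_cast (hg j hj).1
    · exact_mod_cast (hg j hj).2
  rw [sum_log_eq_sum_vonMangoldt_mul_card _ _ N hg] at hup
  refine le_trans ?_ hup
  have hterm : ∀ d, 0 ≤ vonMangoldt d * (#{j ∈ Ioc a b | d ∣ 2 * k * j + 1} : ℝ) := fun d ↦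
    mul_nonneg vonMangoldt_nonneg (Nat.cast_nonneg _)
  -- The contributions do not overlap: d ≤ t ≤ N/2 for the factorial part, d > N/2 for the primes.
  rw [← sum_Ioc_consecutive _ (Nat.zero_le (N / 2)) (Nat.div_le_self N 2), add_comm]
  refine add_le_add ?_ ?_
  · calc _ ≤ ∑ d ∈ Ioc 0 (b - a) with d.Coprime (2 * k),
          vonMangoldt d * (#{j ∈ Ioc a b | d ∣ 2 * k * j + 1} : ℝ) := by
          refine sum_le_sum fun d hd ↦ mul_le_mul_of_nonneg_left ?_ vonMangoldt_nonneg
          rw [mem_filter, mem_Ioc] at hd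
          exact_mod_cast div_le_card_dvd_mul_add_one hd.1.1 hd.2 a b
      _ ≤ _ := sum_le_sum_of_subset_of_nonneg
          ((filter_subset _ _).trans (Ioc_subset_Ioc_right ((Nat.sub_le b a).trans hb2))) fun d _ _ ↦ hterm d
  · refine le_trans ?_ (sum_le_sum_of_subset_of_nonneg
      (filter_subset (fun p ↦ p.Prime ∧ p % k = 1) _) fun d _ _ ↦ hterm d)
    refine sum_le_sum fun p hp ↦ ?_
    obtain ⟨hp, hpp, hpk⟩ := mem_filter.1 hp
    rw [mem_Ioc] at hp
    rw [vonMangoldt_apply_prime hpp]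
    refine le_mul_of_one_le_right (Real.log_natCast_nonneg p) ?_
    have hpodd : p % 2 = 1 := Nat.odd_iff.1 (hpp.odd_of_ne_two (by omega))
    have hdvd : 2 * k ∣ p - 1 := by
      refine Nat.Coprime.mul_dvd_of_dvd_of_dvd (Nat.coprime_two_left.2 hodd) (by omega) ?_
      rw [← Nat.div_add_mod p k, hpk]
      simp
    obtain ⟨j, hj⟩ := hdvd
    have hpj : p = 2 * k * j + 1 := by omega
    have hmem : j ∈ {j ∈ Ioc a b | p ∣ 2 * k * j + 1} := by
      rw [mem_filter, mem_Ioc, ← hpj]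
      refine ⟨⟨?_, ?_⟩, dvd_rfl⟩
      · rw [ha, Nat.div_lt_iff_lt_mul (by omega)]
        have : j * (2 * (2 * k)) = 2 * (2 * k * j) := by ring
        omega
      · rw [hb, Nat.le_div_iff_mul_le (by omega), mul_comm]
        omega
    exact_mod_cast card_pos.2 ⟨j, hmem⟩

/-- Restoring the 2- and k-parts of t! gives at most t log N - log t! + t log 2 + 0.41 t, where t ≤
N/20 + 1. This is at most N/20 + 4.1 t, and 1/20 + 4.1/20 = 0.255. -/
theorem sum_prime_log_one_mod_le {k N : ℕ} (hk : 5 ≤ k) (hkp : k.Prime) (hN : 100 ≤ N) :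
    ∑ p ∈ Ioc (N / 2) N with p.Prime ∧ p % k = 1, Real.log p ≤ 0.255 * N + 5 := by
  have hodd : Odd k := hkp.odd_of_ne_two (by omega)
  have h1 := sum_prime_log_add_sum_le hk hodd hN
  set t := (N - 1) / (2 * k) - (N - 2) / (2 * (2 * k)) with ht
  have h2 := log_factorial_le_sum_coprime_add hkp t
  have h3 := mul_log_sub_self_le_log_factorial t
  have hk' : (5 : ℝ) ≤ k := by exact_mod_cast hk
  have hN' : (100 : ℝ) ≤ N := by exact_mod_cast hN
  have htN : (t : ℝ) ≤ N / 20 + 1 := by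
    have e1 : (2 * (2 * k)) * ((N - 1) / (2 * k)) ≤ 2 * (N - 1) := by
      have := Nat.mul_div_le (N - 1) (2 * k)
      nlinarith
    have e2 : N - 2 < (2 * (2 * k)) * ((N - 2) / (2 * (2 * k)) + 1) := by
      have := Nat.lt_div_mul_add (a := N - 2) (b := 2 * (2 * k)) (by omega)
      linarith
    have e3 : (2 * (2 * k)) * t ≤ N + 2 * (2 * k) := by
      rw [ht, Nat.mul_sub]
      rw [mul_add] at e2
      omega
    have e4 : (4 * (k : ℝ)) * t ≤ N + 4 * k := by
      have : ((2 * (2 * k) * t : ℕ) : ℝ) ≤ ((N + 2 * (2 * k) : ℕ) : ℝ) := by exact_mod_cast e3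
      push_cast at this
      linarith
    by_contra! hcon
    nlinarith
  clear_value t
  have hlogk : Real.log k * ((t / (k - 1) : ℕ) : ℝ) ≤ 0.41 * t := by
    -- Tangent at k = 5, the extremal case: log 5 / 4 < 0.41.
    have e1 : Real.log k ≤ 0.41 * (k - 1) := by
      have := Real.log_le_sub_one_of_pos (x := (k : ℝ) / 5) (by positivity)
      rw [Real.log_div (by positivity) (by positivity)] at this
      linarith [Real.log_five_lt_d9]
    have e2 : ((t / (k - 1) : ℕ) : ℝ) ≤ t / ((k : ℝ) - 1) := by
      refine Nat.cast_div_le.trans_eq ?_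
      rw [Nat.cast_sub (by omega), Nat.cast_one]
    have e3 : ((t / (k - 1) : ℕ) : ℝ) * (k - 1) ≤ t := by rwa [le_div_iff₀ (by linarith)] at e2
    have e4 : (0 : ℝ) ≤ ((t / (k - 1) : ℕ) : ℝ) := by positivity
    nlinarith
  have hlogt : t * Real.log N ≤ t * Real.log t + N / 20 + t * (2 * Real.log 2 + Real.log 5 - 1) := by
    rcases t.eq_zero_or_pos with h0 | h0
    · rw [h0]
      norm_num
      linarith
    · have ht0 : (0 : ℝ) < t := by exact_mod_cast h0
      -- Tangent at t = N/20, essentially the largest t.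
      have e1 := Real.log_le_sub_one_of_pos (x := (N : ℝ) / (t * (2 ^ 2 * 5))) (by positivity)
      rw [Real.log_div (by positivity) (by positivity), Real.log_mul (by positivity) (by positivity),
        Real.log_mul (by positivity) (by positivity), Real.log_pow] at e1
      have e2 := mul_le_mul_of_nonneg_left e1 ht0.le
      have e3 : t * ((N : ℝ) / (t * (2 ^ 2 * 5)) - 1) = N / 20 - t := by
        field_simp
        ring
      rw [e3] at e2
      push_cast at e2
      linarith
  have hc : t * (3 * Real.log 2 + Real.log 5 + 0.41) ≤ t * (4.1 : ℝ) := by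
    gcongr
    linarith [Real.log_two_lt_d9, Real.log_five_lt_d9]
  linarith

/-! ### Primes ≡ 1 mod 3 -/

/-- The nontrivial Dirichlet character modulo `3`, as a real function on `ℕ`. -/
noncomputable def chiThree (n : ℕ) : ℝ := if n % 3 = 1 then 1 else if n % 3 = 2 then -1 else 0

theorem chiThree_mul (m n : ℕ) : chiThree (m * n) = chiThree m * chiThree n := by
  have h : m % 3 = 0 ∨ m % 3 = 1 ∨ m % 3 = 2 := by omega
  have h' : n % 3 = 0 ∨ n % 3 = 1 ∨ n % 3 = 2 := by omega
  rcases h with h | h | h <;> rcases h' with h' | h' | h' <;>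
    simp [chiThree, Nat.mul_mod, h, h']

theorem sum_chiThree (n : ℕ) : ∑ r ∈ Ioc 0 n, chiThree r = if n % 3 = 1 then 1 else 0 := by
  induction n with
  | zero => simp
  | succ n ih =>
    rw [sum_Ioc_succ_top (Nat.zero_le n), ih, chiThree]
    have h : n % 3 = 0 ∨ n % 3 = 1 ∨ n % 3 = 2 := by omega
    rcases h with h | h | h <;> simp [Nat.add_mod, h]

/-- Consecutive terms pair as log(3m + 1) - log(3m + 2) ≤ 0. -/
theorem sum_chiThree_mul_log_le (n : ℕ) :
    ∑ m ∈ Ioc 0 n, chiThree m * Real.log m ≤ if n % 3 = 1 then Real.log n else 0 := by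
  induction n with
  | zero => simp
  | succ n ih =>
    rw [sum_Ioc_succ_top (Nat.zero_le n), chiThree]
    have h : n % 3 = 0 ∨ n % 3 = 1 ∨ n % 3 = 2 := by omega
    rcases h with h | h | h
    · simpa [Nat.add_mod, h] using ih
    · have hn : (0 : ℝ) < n := by exact_mod_cast (show 0 < n by omega)
      have : Real.log n ≤ Real.log (n + 1) := Real.log_le_log hn (by linarith)
      simp [Nat.add_mod, h] at ih ⊢
      linarith
    · simpa [Nat.add_mod, h] using ih

/-- Twisting log = Λ * 1 by the completely multiplicative χ gives χ log = (χΛ) * χ; the inner sum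
over r ≤ N/d is `sum_chiThree`. -/
theorem sum_chiThree_mul_log_eq (N : ℕ) :
    ∑ n ∈ Ioc 0 N, chiThree n * Real.log n =
      ∑ d ∈ Ioc 0 N, chiThree d * vonMangoldt d * if N / d % 3 = 1 then 1 else 0 := by
  let f : ArithmeticFunction ℝ := ⟨fun n ↦ chiThree n * vonMangoldt n, by simp⟩
  let g : ArithmeticFunction ℝ := ⟨chiThree, by simp [chiThree]⟩
  have h := sum_Ioc_mul_eq_sum_sum f g N
  have hfg : ∀ n, (f * g) n = chiThree n * Real.log n := by
    intro n
    rw [mul_apply, ← vonMangoldt_sum, mul_sum,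
      ← Nat.sum_divisorsAntidiagonal (fun d _ ↦ chiThree n * vonMangoldt d)]
    refine sum_congr rfl fun x hx ↦ ?_
    change chiThree x.1 * vonMangoldt x.1 * chiThree x.2 = _
    rw [← (Nat.mem_divisorsAntidiagonal.1 hx).1, chiThree_mul]
    ring
  simp_rw [hfg] at h
  rw [h]
  refine sum_congr rfl fun d _ ↦ ?_
  rw [← sum_chiThree]
  rfl

/-- In that identity the primes in (N/2, N] have ⌊N/d⌋ = 1 and, by hypothesis, χ ≥ 0, while those in
(N/4, N/2] have ⌊N/d⌋ = 2 or 3 and drop out. Negative terms come only from d ≤ N/4, costing at most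
ψ(N/4), and from proper prime powers, costing at most ψ(N) - θ(N). -/
theorem sum_prime_log_one_mod_three_le {N : ℕ} (hN : 4 ≤ N)
    (h : ∀ p ∈ Ioc (N / 2) N, p.Prime → p % 3 ≠ 2) :
    ∑ p ∈ Ioc (N / 2) N with p.Prime ∧ p % 3 = 1, Real.log p ≤
      Real.log N + Chebyshev.psi (N / 4 : ℕ) + (Chebyshev.psi N - Chebyshev.theta N) := by
  have hE : ∑ d ∈ Ioc 0 N, chiThree d * vonMangoldt d * (if N / d % 3 = 1 then 1 else 0) ≤
      Real.log N := by
    rw [← sum_chiThree_mul_log_eq]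
    refine (sum_chiThree_mul_log_le N).trans ?_
    split_ifs
    · exact le_rfl
    · exact Real.log_natCast_nonneg N
  have hsub : Ioc 0 (N / 4) = {d ∈ Ioc 0 N | d ≤ N / 4} := by
    ext d
    simp only [mem_Ioc, mem_filter]
    omega
  have hsub' : {p ∈ Ioc (N / 2) N | p.Prime ∧ p % 3 = 1} =
      {p ∈ Ioc 0 N | N / 2 < p ∧ p.Prime ∧ p % 3 = 1} := by
    ext d
    simp only [mem_Ioc, mem_filter]
    constructor
    · rintro ⟨⟨h1, h2⟩, h3⟩
      exact ⟨⟨by omega, h2⟩, h1, h3⟩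
    · rintro ⟨⟨-, h2⟩, h1, h3⟩
      exact ⟨⟨h1, h2⟩, h3⟩
  rw [Chebyshev.psi_sub_theta_eq_sum_not_prime, Nat.floor_natCast, psi_natCast, hsub, hsub']
  refine le_trans ?_ (add_le_add_left (add_le_add_left hE _) _)
  simp_rw [sum_filter]
  rw [← sum_add_distrib, ← sum_add_distrib]
  refine sum_le_sum fun d hd ↦ ?_
  rw [mem_Ioc] at hd
  have hΛ : 0 ≤ vonMangoldt d := vonMangoldt_nonneg
  have hlow : -vonMangoldt d ≤ chiThree d * vonMangoldt d * if N / d % 3 = 1 then 1 else 0 := by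
    unfold chiThree
    split_ifs <;> linarith
  by_cases hp : d.Prime
  · by_cases h4 : d ≤ N / 4
    · rw [if_neg (by omega), if_pos h4, if_neg (not_not.2 hp)]
      linarith
    by_cases h2 : d ≤ N / 2
    · have hlt : N / d < 4 := (Nat.div_lt_iff_lt_mul hd.1).2 (by omega)
      have hge : 2 ≤ N / d := (Nat.le_div_iff_mul_le hd.1).2 (by omega)
      rw [if_neg (by omega), if_neg h4, if_neg (not_not.2 hp), if_neg (by omega)]
      simp
    · have hlt : N / d < 2 := (Nat.div_lt_iff_lt_mul hd.1).2 (by omega)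
      have hge : 1 ≤ N / d := (Nat.le_div_iff_mul_le hd.1).2 (by omega)
      have h3 := h d (mem_Ioc.2 ⟨by omega, hd.2⟩) hp
      rw [if_neg h4, if_neg (not_not.2 hp), if_pos (show N / d % 3 = 1 by omega),
        vonMangoldt_apply_prime hp, chiThree]
      by_cases h1 : d % 3 = 1
      · simp [h1, hp, not_le.1 h2]
      · simp [h1, h3]
  · rw [if_neg (by tauto), if_pos hp]
    split_ifs at hlow ⊢ <;> linarith

/-! ### Existence of the prime p -/

/-- For every odd prime `k`, some prime in `(N / 2, N]` is neither `k` nor `1` modulo `k`. -/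
theorem exists_prime_mod_ne_one_of_large {k N : ℕ} (hk : k.Prime) (hk2 : k ≠ 2)
    (hN : 10 ^ 8 ≤ N) : ∃ p, p.Prime ∧ N < 2 * p ∧ p ≤ N ∧ p ≠ k ∧ p % k ≠ 1 := by
  by_contra! hcon
  have hN' : (10 : ℝ) ^ 8 ≤ N := by exact_mod_cast hN
  have hlow := sum_prime_log_half_ge hN
  have hlog := log_le_mul hN'
  have h1 : ∀ p ∈ Ioc (N / 2) N, p.Prime → p ≠ k → p % k = 1 := fun p hp hpp hpk ↦ by
    rw [mem_Ioc] at hp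
    exact hcon p hpp (by omega) hp.2 hpk
  -- The prime k itself may lie in the interval, at a cost of at most log N.
  have hsplit : ∑ p ∈ Ioc (N / 2) N with p.Prime, Real.log p ≤
      ∑ p ∈ Ioc (N / 2) N with p.Prime ∧ p % k = 1, Real.log p + Real.log N := by
    have hsub : {p ∈ Ioc (N / 2) N | p.Prime} ⊆
        {p ∈ Ioc (N / 2) N | p.Prime ∧ p % k = 1} ∪ {p ∈ Ioc (N / 2) N | p = k} := by
      intro p hp
      obtain ⟨hp, hpp⟩ := mem_filter.1 hp
      rw [mem_union, mem_filter, mem_filter]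
      by_cases hpk : p = k
      · exact Or.inr ⟨hp, hpk⟩
      · exact Or.inl ⟨hp, hpp, h1 p hp hpp hpk⟩
    have hnn : ∀ p : ℕ, 0 ≤ Real.log p := Real.log_natCast_nonneg
    refine (sum_le_sum_of_subset_of_nonneg hsub fun p _ _ ↦ hnn p).trans ?_
    refine (le_add_of_nonneg_right (sum_nonneg fun p _ ↦ hnn p)).trans
      (sum_union_inter.trans_le (add_le_add le_rfl ?_))
    rw [filter_eq']
    split_ifs with hmem
    · rw [sum_singleton]
      exact Real.log_le_log (by exact_mod_cast hk.pos) (by exact_mod_cast (mem_Ioc.1 hmem).2)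
    · simpa using hnn N
  by_cases hk3 : k = 3
  · subst hk3
    have h2 := sum_prime_log_one_mod_three_le (N := N) (by omega) fun p hp hpp ↦ by
      have := h1 p hp hpp (by have := mem_Ioc.1 hp; omega)
      omega
    have h3 := psi_le_mul_add (N / 4)
    have h4 : ((N / 4 : ℕ) : ℝ) ≤ N / 4 := Nat.cast_div_le
    have h5 := psi_sub_theta_le_mul hN
    linarith
  · have hk5 : 5 ≤ k := by
      by_contra! hlt
      have := hk.two_le
      interval_cases k
      · exact hk2 rfl
      · exact hk3 rfl
      · exact absurd hk (by norm_num)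
    have h2 := sum_prime_log_one_mod_le hk5 hk (N := N) (by omega)
    linarith

/-- An odd k cannot divide both p₁ - 1 and p₂ - 1, whose gcd is a power of 2, so one of the two
primes is ≢ 1 mod k. If p₁ = k, then p₂ works: its residue p₂ - k is even. -/
theorem exists_prime_mod_ne_one_of_pair {p₁ p₂ N k : ℕ} (hp₁ : p₁.Prime) (hp₂ : p₂.Prime)
    (hlt : p₁ < p₂) (hgcd : Nat.gcd (p₁ - 1) (p₂ - 1) ∣ 2 ^ 20) (h2 : p₂ ≤ N) (h1 : N < 2 * p₁)
    (hk : k.Prime) (hk2 : k ≠ 2) :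
    ∃ p, p.Prime ∧ N < 2 * p ∧ p ≤ N ∧ p ≠ k ∧ p % k ≠ 1 := by
  have hndvd : ¬ (p₁ % k = 1 ∧ p₂ % k = 1) := by
    rintro ⟨e1, e2⟩
    have d1 : k ∣ p₁ - 1 := (Nat.modEq_iff_dvd' hp₁.one_le).1
      ((Nat.mod_eq_of_lt hk.one_lt).trans e1.symm)
    have d2 : k ∣ p₂ - 1 := (Nat.modEq_iff_dvd' hp₂.one_le).1
      ((Nat.mod_eq_of_lt hk.one_lt).trans e2.symm)
    exact hk2 ((Nat.prime_dvd_prime_iff_eq hk Nat.prime_two).1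
      (hk.dvd_of_dvd_pow ((Nat.dvd_gcd d1 d2).trans hgcd)))
  have hoddk := Nat.odd_iff.1 (hk.odd_of_ne_two hk2)
  by_cases e1 : p₁ % k = 1
  · refine ⟨p₂, hp₂, by omega, h2, ?_, fun e2 ↦ hndvd ⟨e1, e2⟩⟩
    rintro rfl
    rw [Nat.mod_eq_of_lt hlt] at e1
    exact hp₁.one_lt.ne' e1
  · by_cases ek : p₁ = k
    · refine ⟨p₂, hp₂, by omega, h2, by omega, fun e2 ↦ ?_⟩
      have h3 : p₂ % k = p₂ - k := by
        rw [Nat.mod_eq_sub_mod (by omega), Nat.mod_eq_of_lt (by omega)]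
      have hodd2 := Nat.odd_iff.1 (hp₂.odd_of_ne_two (by have := hk.two_le; omega))
      omega
    · exact ⟨p₁, hp₁, h1, by omega, ek, e1⟩

/-- Each pair serves p₂ ≤ N < 2p₁, and the next p₂ is at most the current 2p₁, so 26 near-doublings
reach 10^8. -/
theorem exists_prime_mod_ne_one_of_small {k N : ℕ} (hk : k.Prime) (hk2 : k ≠ 2) (hN11 : 11 ≤ N)
    (hN : N < 10 ^ 8) : ∃ p, p.Prime ∧ N < 2 * p ∧ p ≤ N ∧ p ≠ k ∧ p % k ≠ 1 := by
  rcases lt_or_ge N (2 * 7) with h | h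
  · exact exists_prime_mod_ne_one_of_pair (p₁ := 7) (p₂ := 11) (by norm_num) (by norm_num)
      (by norm_num) (by norm_num) (by omega) h hk hk2
  rcases lt_or_ge N (2 * 11) with h | h
  · exact exists_prime_mod_ne_one_of_pair (p₁ := 11) (p₂ := 13) (by norm_num) (by norm_num)
      (by norm_num) (by norm_num) (by omega) h hk hk2
  rcases lt_or_ge N (2 * 17) with h | h
  · exact exists_prime_mod_ne_one_of_pair (p₁ := 17) (p₂ := 19) (by norm_num) (by norm_num)
      (by norm_num) (by norm_num) (by omega) h hk hk2
  rcases lt_or_ge N (2 * 29) with h | h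
  · exact exists_prime_mod_ne_one_of_pair (p₁ := 29) (p₂ := 31) (by norm_num) (by norm_num)
      (by norm_num) (by norm_num) (by omega) h hk hk2
  rcases lt_or_ge N (2 * 47) with h | h
  · exact exists_prime_mod_ne_one_of_pair (p₁ := 47) (p₂ := 53) (by norm_num) (by norm_num)
      (by norm_num) (by norm_num) (by omega) h hk hk2
  rcases lt_or_ge N (2 * 83) with h | h
  · exact exists_prime_mod_ne_one_of_pair (p₁ := 83) (p₂ := 89) (by norm_num) (by norm_num)
      (by norm_num) (by norm_num) (by omega) h hk hk2
  rcases lt_or_ge N (2 * 149) with h | h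
  · exact exists_prime_mod_ne_one_of_pair (p₁ := 149) (p₂ := 163) (by norm_num) (by norm_num)
      (by norm_num) (by norm_num) (by omega) h hk hk2
  rcases lt_or_ge N (2 * 283) with h | h
  · exact exists_prime_mod_ne_one_of_pair (p₁ := 283) (p₂ := 293) (by norm_num) (by norm_num)
      (by norm_num) (by norm_num) (by omega) h hk hk2
  rcases lt_or_ge N (2 * 557) with h | h
  · exact exists_prime_mod_ne_one_of_pair (p₁ := 557) (p₂ := 563) (by norm_num) (by norm_num)
      (by norm_num) (by norm_num) (by omega) h hk hk2
  rcases lt_or_ge N (2 * 1103) with h | h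
  · exact exists_prime_mod_ne_one_of_pair (p₁ := 1103) (p₂ := 1109) (by norm_num) (by norm_num)
      (by norm_num) (by norm_num) (by omega) h hk hk2
  rcases lt_or_ge N (2 * 2153) with h | h
  · exact exists_prime_mod_ne_one_of_pair (p₁ := 2153) (p₂ := 2203) (by norm_num) (by norm_num)
      (by norm_num) (by norm_num) (by omega) h hk hk2
  rcases lt_or_ge N (2 * 4289) with h | h
  · exact exists_prime_mod_ne_one_of_pair (p₁ := 4289) (p₂ := 4297) (by norm_num) (by norm_num)
      (by norm_num) (by norm_num) (by omega) h hk hk2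
  rcases lt_or_ge N (2 * 8563) with h | h
  · exact exists_prime_mod_ne_one_of_pair (p₁ := 8563) (p₂ := 8573) (by norm_num) (by norm_num)
      (by norm_num) (by norm_num) (by omega) h hk hk2
  rcases lt_or_ge N (2 * 17117) with h | h
  · exact exists_prime_mod_ne_one_of_pair (p₁ := 17117) (p₂ := 17123) (by norm_num) (by norm_num)
      (by norm_num) (by norm_num) (by omega) h hk hk2
  rcases lt_or_ge N (2 * 34213) with h | h
  · exact exists_prime_mod_ne_one_of_pair (p₁ := 34213) (p₂ := 34217) (by norm_num) (by norm_num)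
      (by norm_num) (by norm_num) (by omega) h hk hk2
  rcases lt_or_ge N (2 * 68389) with h | h
  · exact exists_prime_mod_ne_one_of_pair (p₁ := 68389) (p₂ := 68399) (by norm_num) (by norm_num)
      (by norm_num) (by norm_num) (by omega) h hk hk2
  rcases lt_or_ge N (2 * 136769) with h | h
  · exact exists_prime_mod_ne_one_of_pair (p₁ := 136769) (p₂ := 136777) (by norm_num) (by norm_num)
      (by norm_num) (by norm_num) (by omega) h hk hk2
  rcases lt_or_ge N (2 * 273521) with h | h
  · exact exists_prime_mod_ne_one_of_pair (p₁ := 273521) (p₂ := 273527) (by norm_num) (by norm_num)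
      (by norm_num) (by norm_num) (by omega) h hk hk2
  rcases lt_or_ge N (2 * 547021) with h | h
  · exact exists_prime_mod_ne_one_of_pair (p₁ := 547021) (p₂ := 547037) (by norm_num) (by norm_num)
      (by norm_num) (by norm_num) (by omega) h hk hk2
  rcases lt_or_ge N (2 * 1093997) with h | h
  · exact exists_prime_mod_ne_one_of_pair (p₁ := 1093997) (p₂ := 1094029) (by norm_num) (by norm_num)
      (by norm_num) (by norm_num) (by omega) h hk hk2
  rcases lt_or_ge N (2 * 2187971) with h | h
  · exact exists_prime_mod_ne_one_of_pair (p₁ := 2187971) (p₂ := 2187979) (by norm_num) (by norm_num)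
      (by norm_num) (by norm_num) (by omega) h hk hk2
  rcases lt_or_ge N (2 * 4375913) with h | h
  · exact exists_prime_mod_ne_one_of_pair (p₁ := 4375913) (p₂ := 4375937) (by norm_num) (by norm_num)
      (by norm_num) (by norm_num) (by omega) h hk hk2
  rcases lt_or_ge N (2 * 8751803) with h | h
  · exact exists_prime_mod_ne_one_of_pair (p₁ := 8751803) (p₂ := 8751817) (by norm_num) (by norm_num)
      (by norm_num) (by norm_num) (by omega) h hk hk2
  rcases lt_or_ge N (2 * 17503573) with h | h
  · exact exists_prime_mod_ne_one_of_pair (p₁ := 17503573) (p₂ := 17503583) (by norm_num) (by norm_num)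
      (by norm_num) (by norm_num) (by omega) h hk hk2
  rcases lt_or_ge N (2 * 35007059) with h | h
  · exact exists_prime_mod_ne_one_of_pair (p₁ := 35007059) (p₂ := 35007121) (by norm_num) (by norm_num)
      (by norm_num) (by norm_num) (by omega) h hk hk2
  rcases lt_or_ge N (2 * 70014083) with h | h
  · exact exists_prime_mod_ne_one_of_pair (p₁ := 70014083) (p₂ := 70014097) (by norm_num) (by norm_num)
      (by norm_num) (by norm_num) (by omega) h hk hk2
  omega

theorem exists_prime_mod_ne_one {k N : ℕ} (hk : k.Prime) (hk2 : k ≠ 2) (hN : 11 ≤ N) :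
    ∃ p, p.Prime ∧ N < 2 * p ∧ p ≤ N ∧ p ≠ k ∧ p % k ≠ 1 :=
  (lt_or_ge N (10 ^ 8)).elim (exists_prime_mod_ne_one_of_small hk hk2 hN)
    (exists_prime_mod_ne_one_of_large hk hk2)

/-! ### The exact power of p in the product -/

theorem dvd_add_of_dvd_pow_add_pow {p ℓ a q : ℕ} (hp : p.Prime) (hℓ : Odd ℓ)
    (hcop : ℓ.Coprime (p - 1)) (hq : ¬ p ∣ q) (h : p ∣ a ^ ℓ + q ^ ℓ) : p ∣ a + q := by
  have : Fact p.Prime := ⟨hp⟩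
  have hq0 : (q : ZMod p) ≠ 0 := by rwa [ne_eq, ZMod.natCast_eq_zero_iff]
  have h0 : (a : ZMod p) ^ ℓ = (-(q : ZMod p)) ^ ℓ := by
    rw [hℓ.neg_pow, eq_neg_iff_add_eq_zero]
    exact_mod_cast (ZMod.natCast_eq_zero_iff _ p).2 h
  have ha0 : (a : ZMod p) ≠ 0 := fun ha ↦ by
    rw [ha, zero_pow hℓ.pos.ne'] at h0
    exact pow_ne_zero ℓ (neg_ne_zero.2 hq0) h0.symm
  have hcard : (Nat.card (ZMod p)ˣ).Coprime ℓ := by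
    rw [Nat.card_eq_fintype_card, ZMod.card_units]
    exact hcop.symm
  have hu : Units.mk0 (a : ZMod p) ha0 = Units.mk0 (-(q : ZMod p)) (neg_ne_zero.2 hq0) :=
    (powCoprime hcard).injective (Units.ext (by simpa using h0))
  have hu' : (a : ZMod p) = -q := congrArg Units.val hu
  rw [← ZMod.natCast_eq_zero_iff]
  push_cast
  rw [hu', neg_add_cancel]

theorem theorem1 (q : ℕ) (hq : 0 < q) (ℓ : ℕ) (hℓ : IsPrimePow ℓ) (hodd : Odd ℓ)
    (n : ℕ) (hn : max (q : ℤ) (11 - (q : ℤ)) ≤ (n : ℤ)) :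
    ¬ IsPowerful (∏ a ∈ Finset.Icc 1 n, (a ^ ℓ + q ^ ℓ)) := by
  rintro ⟨-, hpow⟩
  obtain ⟨k, s, hk, hs, rfl⟩ := (isPrimePow_nat_iff ℓ).1 hℓ
  have hk2 : k ≠ 2 := by
    rintro rfl
    exact absurd (hodd.of_dvd_nat (dvd_pow_self 2 hs.ne')) (by decide)
  have hqn : q ≤ n := by exact_mod_cast (le_max_left _ _).trans hn
  have hN : 11 ≤ n + q := by
    have := (le_max_right _ _).trans hn
    omega
  obtain ⟨p, hp, hNp, hpN, hpk, hpk1⟩ := exists_prime_mod_ne_one hk hk2 hN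
  have hqp : ¬ p ∣ q := fun h ↦ by
    have := Nat.le_of_dvd hq h
    omega
  have hcop : (k ^ s).Coprime (p - 1) := by
    refine Nat.Coprime.pow_left s ((Nat.Prime.coprime_iff_not_dvd hk).2 fun h ↦ hpk1 ?_)
    obtain ⟨m, hm⟩ := h
    have hpm : p = 1 + k * m := by have := hp.two_le; omega
    rw [hpm, Nat.add_mul_mod_self_left, Nat.mod_eq_of_lt hk.one_lt]
  have hmem : p - q ∈ Icc 1 n := mem_Icc.2 ⟨by omega, by omega⟩
  have hsum : p - q + q = p := by omega
  have hdvd : p ∣ (p - q) ^ k ^ s + q ^ k ^ s := by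
    have := hodd.nat_add_dvd_pow_add_pow (p - q) q
    rwa [hsum] at this
  have hsq := hpow p hp (hdvd.trans (dvd_prod_of_mem (fun a ↦ a ^ k ^ s + q ^ k ^ s) hmem))
  rw [← mul_prod_erase _ _ hmem] at hsq
  have hrest : ¬ p ∣ ∏ a ∈ (Icc 1 n).erase (p - q), (a ^ k ^ s + q ^ k ^ s) := by
    rw [hp.prime.dvd_finsetProd_iff]
    rintro ⟨a, ha, hpa⟩
    obtain ⟨hne, ha⟩ := mem_erase.1 ha
    rw [mem_Icc] at ha
    obtain ⟨c, hc⟩ := dvd_add_of_dvd_pow_add_pow hp hodd hcop hqp hpa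
    have hc1 : c = 1 := by
      have hc2 : c < 2 := by
        by_contra! h2
        have := Nat.mul_le_mul_left p h2
        omega
      have hc0 : c ≠ 0 := by
        rintro rfl
        omega
      omega
    subst hc1
    omega
  have hsq' : p ^ 2 ∣ (p - q) ^ k ^ s + q ^ k ^ s :=
    (((Nat.Prime.coprime_iff_not_dvd hp).2 hrest).pow_left 2).dvd_of_dvd_mul_right hsq
  have : Fact p.Prime := ⟨hp⟩
  have hpodd : Odd p := hp.odd_of_ne_two (by omega)
  have hpa : ¬ p ∣ p - q := fun h ↦ hqp ((Nat.dvd_add_right h).1 (by rw [hsum]))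
  -- Lifting the exponent; p ≠ k makes the valuation of the exponent vanish.
  have hval := padicValNat.pow_add_pow hpodd (by rw [hsum] : p ∣ p - q + q) hpa hodd
  have hpk' : ¬ p ∣ k ^ s := fun h ↦
    hpk ((Nat.prime_dvd_prime_iff_eq hp hk).1 (hp.dvd_of_dvd_pow h))
  rw [hsum, padicValNat_self, padicValNat.eq_zero_of_not_dvd hpk'] at hval
  have := (padicValNat_dvd_iff_le (p := p) (n := 2) (by positivity)).1 hsq'
  omega
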